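/- A destination D (the warden) observes $n\ge 1$ received symbols $y=(y_1,\dots,y_n)\in\mathbb C^n$ and tests whether a relay R, which forwards a source message with power $P_{\rm R}>0$, additionally sends a covert message with power $P_\Delta>0$. Let $P_{\rm S}>0$ be the transmit power of the source, $\sigma^2>0$ the noise power, $\Omega>0$ the mean power gain of the channel from R to D, and $\beta\in(0,1)$ the degree of channel uncertainty, and let $g_{\rm S},g_{\rm R}\ge 0$ be the power gains of the source–destination channel and of the estimated part of the relay–destination channel (that is, $g_{\rm S}=|h_{\rm SD}|^2$ and $g_{\rm R}=|\hat h_{\rm RD}|^2$, or their mean values). All these numbers, in particular the noise power, are known to D. The channel estimation error $\tilde h\sim\mathcal{CN}(0,\beta\Omega)$ is unknown to D. Put $P_0=P_{\rm R}$, $P_1=P_{\rm R}+P_\Delta$ and $$v_q(\tilde h)=P_{\rm S}g_{\rm S}+P_q g_{\rm R}+P_q|\tilde h|^2+\sigma^2\qquad(q=0,1).$$ Under hypothesis $\mathcal H_q$ the symbols are, conditionally on $\tilde h$, independent with law $\mathcal{CN}(0,v_q(\tilde h))$; thus, unconditionally, their law is a mixture over a shifted exponential variance. A detector is a measurable function $\delta$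 of the observation with values in $[0,1]$, the probability of deciding for $\mathcal H_1$ (randomization is allowed), with $\mathbb P_{\rm FA}(\delta)=\mathbb E_{\mathcal H_0}[\delta]$, $\mathbb P_{\rm MD}(\delta)=\mathbb E_{\mathcal H_1}[1-\delta]$ and $\mathbb P_{\rm E}=\mathbb P_{\rm FA}+\mathbb P_{\rm MD}$. The radiometer with threshold $\tau\in\mathbb R$ decides for $\mathcal H_1$ if and only if $T_n(y)=\frac1n\sum_{\omega=1}^n|y_\omega|^2>\tau$. Then the radiometer is the optimal detector, in the following sense. 1. For every $n\ge1$, the likelihood ratio $\Lambda(y)=\mathbb E_{\tilde h}[f_{v_1(\tilde h)}(y)]/\mathbb E_{\tilde h}[f_{v_0(\tilde h)}(y)]$, where $f_v(y)=\prod_{\omega}\frac{1}{\pi v}e^{-|y_\omega|^2/v}$, is a non-decreasing function of $T_n(y)$. There is $\tau$ such that $\Lambda(y)>1\iff T_n(y)>\tau$ for all $y\in\mathbb C^n$, and the radiometer with this threshold minimizes $\mathbb P_{\rm E}$ among all detectors. Moreover, for every $\tau$ the radiometer has the smallest $\mathbb P_{\rm MD}$ among all detectors whose $\mathbb P_{\rm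 FA}$ does not exceed its own, and every level $\alpha\in(0,1]$ is the false alarm probability of some radiometer. 2. At infinite blocklength, where D observes a sequence $(y_\omega)_{\omega\ge1}$ with the same conditional law: under $\mathcal H_q$, for every value of $\tilde h$, $T_n\to v_q(\tilde h)$ almost surely as $n\to\infty$. For every $\tau$, the false alarm and missed detection probabilities of the radiometer on $n$ symbols converge to those of the limit radiometer, which decides for $\mathcal H_1$ if and only if $T=\lim_n T_n>\tau$. Some limit radiometer minimizes $\mathbb P_{\rm E}$ among all detectors based on the whole sequence; every limit radiometer has the smallest $\mathbb P_{\rm MD}$ among all such detectors whose $\mathbb P_{\rm FA}$ does not exceed its own; and every $\alpha\in(0,1]$ is the false alarm probability of some limit radiometer. -/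

import Mathlib

open MeasureTheory ProbabilityTheory Filter Topology
open scoped NNReal ENNReal

noncomputable section

namespace CovertDetection

/-- The circularly symmetric complex Gaussian law `CN(0, v)`: real and imaginary parts are
independent real Gaussians with mean `0` and variance `v / 2` each. -/
def complexGaussian (v : ℝ≥0) : Measure ℂ :=
  ((gaussianReal 0 (v / 2)).prod (gaussianReal 0 (v / 2))).map Complex.measurableEquivRealProd.symm

instance isProbabilityMeasure_complexGaussian (v : ℝ≥0) :
    IsProbabilityMeasure (complexGaussian v) :=
  Measure.isProbabilityMeasure_map Complex.measurableEquivRealProd.symm.measurable.aemeasurable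

theorem measurable_complexGaussian : Measurable complexGaussian := by
  have h1 : Measurable (fun v : ℝ≥0 => gaussianReal 0 (v / 2)) :=
    measurable_gaussianReal.comp (measurable_const.prodMk (measurable_id.div_const 2))
  let κ : Kernel ℝ≥0 ℝ := ⟨fun v => gaussianReal 0 (v / 2), h1⟩
  have : IsMarkovKernel κ :=
    ⟨fun v => inferInstanceAs (IsProbabilityMeasure (gaussianReal 0 (v / 2)))⟩
  have h2 : (fun v => (κ ×ₖ κ) v) =
      fun v : ℝ≥0 => (gaussianReal 0 (v / 2)).prod (gaussianReal 0 (v / 2)) := by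
    funext v
    rw [Kernel.prod_apply]
    rfl
  have h3 : Measurable
      (fun v : ℝ≥0 => (gaussianReal 0 (v / 2)).prod (gaussianReal 0 (v / 2))) :=
    h2 ▸ (κ ×ₖ κ).measurable
  exact (Measure.measurable_map _ Complex.measurableEquivRealProd.symm.measurable).comp h3

/-- The two hypotheses of the warden: no covert message (`H0`), covert message (`H1`). -/
inductive Hypothesis
  | H0
  | H1

/-- The data of one full-duplex transmission slot, all known to the destination.
`gainSD` and `gainRD` are the known power gains of the two channels, i.e. `|h_SD|²` and `|ĥ_RD|²`
(or, if only the statistics are known, `Ω_SD` and `(1 - β) Ω_RD`). -/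
structure Slot where
  /-- transmit power of the source -/
  PS : ℝ
  /-- transmit power of the relay for the forwarded message -/
  PR : ℝ
  /-- transmit power of the relay for the covert message -/
  PΔ : ℝ
  /-- noise power `σ_D²` at the destination -/
  noise : ℝ
  /-- mean power gain of the channel from the relay to the destination -/
  ΩRD : ℝ
  /-- degree of channel uncertainty -/
  β : ℝ
  /-- known power gain of the channel from the source to the destination -/
  gainSD : ℝ
  /-- power gain of the estimated part of the channel from the relay to the destination -/
  gainRD : ℝ
  PS_pos : 0 < PS
  PR_pos : 0 < PR
  PΔ_pos : 0 < PΔ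
  noise_pos : 0 < noise
  ΩRD_pos : 0 < ΩRD
  β_mem : β ∈ Set.Ioo (0 : ℝ) 1
  gainSD_nonneg : 0 ≤ gainSD
  gainRD_nonneg : 0 ≤ gainRD

namespace Slot

variable (S : Slot)

/-- Total transmit power of the relay. -/
def relayPower : Hypothesis → ℝ
  | .H0 => S.PR
  | .H1 => S.PR + S.PΔ

/-- The variance of each received symbol, given the value `h` of the channel estimation error. -/
def variance (q : Hypothesis) (h : ℂ) : ℝ :=
  S.PS * S.gainSD + S.relayPower q * S.gainRD + S.relayPower q * ‖h‖ ^ 2 + S.noise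

theorem measurable_variance (q : Hypothesis) : Measurable (S.variance q) := by
  unfold variance
  fun_prop

/-- The law `CN(0, β Ω_RD)` of the channel estimation error, constant during the slot. -/
def errorLaw : Measure ℂ := complexGaussian (S.β * S.ΩRD).toNNReal

/-- Conditional law, given the channel estimation error, of the received symbols with indices
in `ι` (`Fin n` for a slot of `n` symbols, `ℕ` for infinite blocklength): they are i.i.d.
with law `CN(0, S.variance q h)`. -/
def receivedKernel (ι : Type) (q : Hypothesis) : Kernel ℂ (ι → ℂ) where
  toFun h := Measure.infinitePi fun _ : ι => complexGaussian (S.variance q h).toNNReal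
  measurable' := by
    refine Measurable.measure_of_isPiSystem_of_isProbabilityMeasure
      (generateFrom_squareCylinders (α := fun _ : ι => ℂ)).symm
      (isPiSystem_squareCylinders (fun _ => MeasurableSpace.isPiSystem_measurableSet)
        (fun _ => Set.mem_ofPred.mpr MeasurableSet.univ)) ?_
    rintro _ ⟨s, t, ht, rfl⟩
    have ht' : ∀ i ∈ s, MeasurableSet (t i) := fun i _ => ht i (Set.mem_univ i)
    simp only [Measure.infinitePi_pi _ ht']
    refine Finset.measurable_prod _ fun i hi => ?_
    exact (Measure.measurable_coe (ht' i hi)).comp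
      (measurable_complexGaussian.comp (S.measurable_variance q).real_toNNReal)

/-- The unconditional law of the received symbols. -/
def receivedLaw (ι : Type) (q : Hypothesis) : Measure (ι → ℂ) :=
  S.errorLaw.bind (S.receivedKernel ι q)

/-- Density of `n` independent `CN(0, v)` symbols. -/
def blockDensity {n : ℕ} (v : ℝ) (y : Fin n → ℂ) : ℝ :=
  ∏ ω, Real.exp (-‖y ω‖ ^ 2 / v) / (Real.pi * v)

/-- Density of the `n` received symbols, averaged over the unknown channel estimation error. -/
def mixtureDensity {n : ℕ} (q : Hypothesis) (y : Fin n → ℂ) : ℝ :=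
  ∫ h, blockDensity (S.variance q h) y ∂S.errorLaw

/-- The likelihood ratio. -/
def likelihoodRatio {n : ℕ} (y : Fin n → ℂ) : ℝ :=
  S.mixtureDensity .H1 y / S.mixtureDensity .H0 y

end Slot

/-- A (possibly randomized) detector: on observing `y` it decides for `H1` with probability
`decide y`. Nonrandomized detectors take values in `{0, 1}`. -/
structure Detector (X : Type) [MeasurableSpace X] where
  /-- probability of deciding for `H1` -/
  decide : X → ℝ
  measurable_decide : Measurable decide
  decide_mem : ∀ y, decide y ∈ Set.Icc (0 : ℝ) 1

open Classical in
/-- The detector that decides for `H1` exactly when the statistic `T` exceeds `τ`. -/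
def thresholdDetector {X : Type} [MeasurableSpace X] (T : X → ℝ) (hT : Measurable T) (τ : ℝ) :
    Detector X where
  decide y := if τ < T y then 1 else 0
  measurable_decide :=
    Measurable.ite (measurableSet_lt measurable_const hT) measurable_const measurable_const
  decide_mem y := by split_ifs <;> simp

/-- Average received power of `n` symbols. -/
def averagePower (n : ℕ) (y : Fin n → ℂ) : ℝ := (∑ ω, ‖y ω‖ ^ 2) / n

theorem measurable_averagePower (n : ℕ) : Measurable (averagePower n) := by
  unfold averagePower
  fun_prop

/-- Average received power of the first `n` symbols of a sequence. -/
def partialPower (y : ℕ → ℂ) (n : ℕ) : ℝ := averagePower n fun ω => y ω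

/-- The limit of the average received power (an arbitrary value where the limit does not exist). -/
def limitPower (y : ℕ → ℂ) : ℝ := limUnder atTop (partialPower y)

theorem measurable_limitPower : Measurable limitPower := by
  refine (StronglyMeasurable.limUnder (l := atTop) (f := fun n y => partialPower y n)
    fun n => ?_).measurable
  refine Measurable.stronglyMeasurable ?_
  exact (measurable_averagePower n).comp (by fun_prop)

/-- The radiometer with threshold `τ` on a slot of `n` symbols. -/
def radiometer (n : ℕ) (τ : ℝ) : Detector (Fin n → ℂ) :=
  thresholdDetector (averagePower n) (measurable_averagePower n) τ

/-- The radiometer with threshold `τ` at infinite blocklength. -/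
def limitRadiometer (τ : ℝ) : Detector (ℕ → ℂ) :=
  thresholdDetector limitPower measurable_limitPower τ

namespace Slot

variable (S : Slot) {ι : Type}

/-- False alarm probability. -/
def falseAlarm (d : Detector (ι → ℂ)) : ℝ := ∫ y, d.decide y ∂S.receivedLaw ι .H0

/-- Missed detection probability. -/
def missedDetection (d : Detector (ι → ℂ)) : ℝ := ∫ y, (1 - d.decide y) ∂S.receivedLaw ι .H1

/-- Detection error probability (for equal priors, twice the probability of a wrong decision). -/
def detectionError (d : Detector (ι → ℂ)) : ℝ := S.falseAlarm d + S.missedDetection d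

/-- No detector has a smaller detection error probability. -/
def MinimizesError (d : Detector (ι → ℂ)) : Prop :=
  ∀ d' : Detector (ι → ℂ), S.detectionError d ≤ S.detectionError d'

/-- No detector with at most the same false alarm probability has a smaller missed detection
probability. -/
def MostPowerful (d : Detector (ι → ℂ)) : Prop :=
  ∀ d' : Detector (ι → ℂ), S.falseAlarm d' ≤ S.falseAlarm d →
    S.missedDetection d ≤ S.missedDetection d'

end Slot

end CovertDetection

end

/-! The channel error enters only through the real variance `v` of the symbols, whose law is
exponential, shifted by `baseVariance q` and with mean excess `excessMean q`. From `H0` to `H1` the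
shift does not decrease and the mean excess increases. So the law of `v` under `H1` has a density
`varianceRatio` with respect to the one under `H0`, and this density is monotone: zero up to
`baseVariance .H1`, an increasing exponential beyond. The proof carries this monotonicity over from
the hidden `v` to the observed power.

For `n` symbols the conditional density depends on the average power `t` alone, and passing from `t`
to a larger `t'` multiplies it by `exp (-n (t' - t) / v)`, which increases with `v`. A larger power
thus shifts the weight towards larger variances, and Chebyshev's association inequality makes the
likelihood ratio monotone in `t` (`powerMixture_mul_le`). The ratio is below `1` at zero power,
continuous, and somewhere above `1`, since two probability densities cannot be ordered without being
equal; this yields the threshold.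

For an infinite sequence the strong law reveals `v`: `symbolKernel ℕ v` lives on `limitPower = v`
(`symbolKernel_eq_zero`), so events about the limit power only involve the corresponding variances
and `varianceRatio` acts as likelihood ratio. In both regimes optimality follows from the
Neyman–Pearson argument `thresholdDetector_tradeoff`, and all levels are attained because the
statistic has no atoms. -/

noncomputable section

namespace CovertDetection

/-! ### Complex Gaussian laws and their squared modulus -/

/-- The density of the circularly symmetric complex Gaussian law with variance `v`. -/
def complexGaussianPDF (v : ℝ) (z : ℂ) : ℝ := Real.exp (-‖z‖ ^ 2 / v) / (Real.pi * v)

theorem measurable_complexGaussianPDF (v : ℝ) : Measurable (complexGaussianPDF v) := by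
  unfold complexGaussianPDF
  fun_prop

theorem complexGaussianPDF_pos {v : ℝ} (hv : 0 < v) (z : ℂ) : 0 < complexGaussianPDF v z := by
  have := Real.pi_pos
  unfold complexGaussianPDF
  positivity

theorem sq_norm_measurableEquivRealProd_symm (p : ℝ × ℝ) :
    ‖Complex.measurableEquivRealProd.symm p‖ ^ 2 = p.1 ^ 2 + p.2 ^ 2 := by
  rw [Complex.measurableEquivRealProd_symm_apply, Complex.sq_norm, Complex.normSq_mk]
  ring

theorem complexGaussian_eq_withDensity {v : ℝ} (hv : 0 < v) :
    complexGaussian v.toNNReal =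
      volume.withDensity fun z => ENNReal.ofReal (complexGaussianPDF v z) := by
  have hv0 : v.toNNReal / 2 ≠ 0 := by
    have : v.toNNReal ≠ 0 := by simpa using hv
    positivity
  have hmp := Complex.volume_preserving_equiv_real_prod.symm
  rw [complexGaussian, gaussianReal_of_var_ne_zero _ hv0,
    prod_withDensity (measurable_gaussianPDF _ _) (measurable_gaussianPDF _ _)]
  ext s hs
  rw [Measure.map_apply hmp.measurable hs, withDensity_apply _ (hmp.measurable hs),
    withDensity_apply _ hs, ← hmp.setLIntegral_comp_preimage_emb
      Complex.measurableEquivRealProd.symm.measurableEmbedding]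
  refine lintegral_congr fun p => ?_
  rw [gaussianPDF, gaussianPDF, ← ENNReal.ofReal_mul (gaussianPDFReal_nonneg _ _ _)]
  congr 1
  have h2 : (2 : ℝ) * ((v.toNNReal / 2 : ℝ≥0) : ℝ) = v := by
    rw [NNReal.coe_div, Real.coe_toNNReal v hv.le]
    push_cast
    ring
  have hc : (2 : ℝ) * Real.pi * ((v.toNNReal / 2 : ℝ≥0) : ℝ) = Real.pi * v := by
    rw [mul_comm 2, mul_assoc, h2]
  have hpos : 0 ≤ Real.pi * v := by have := Real.pi_pos; positivity
  simp only [gaussianPDFReal, complexGaussianPDF, sq_norm_measurableEquivRealProd_symm, h2, hc, sub_zero]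
  rw [mul_mul_mul_comm, ← mul_inv, Real.mul_self_sqrt hpos, ← Real.exp_add,
    div_eq_inv_mul _ (Real.pi * v)]
  congr 2
  ring

/-- Affine functions of the squared modulus of a complex Gaussian variable follow a shifted
exponential law. -/
theorem lintegral_affine_sq_norm_complexGaussian {l c p : ℝ} (hl : 0 < l) (hp : 0 < p)
    (F : ℝ → ℝ≥0∞) (hF : Measurable F) :
    ∫⁻ z, F (c + p * ‖z‖ ^ 2) ∂complexGaussian l.toNNReal =
      ∫⁻ v in Set.Ioi c, ENNReal.ofReal ((p * l)⁻¹ * Real.exp (-(v - c) / (p * l))) * F v := by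
  have hpi := Real.pi_pos
  rw [complexGaussian_eq_withDensity hl, lintegral_withDensity_eq_lintegral_mul _
    (measurable_complexGaussianPDF l).ennreal_ofReal (by fun_prop),
    ← Complex.lintegral_comp_polarCoord_symm]
  -- Substitution `v = c + p * r ^ 2`: its derivative `2 * p * r` absorbs the polar Jacobian `r`,
  -- and the angle contributes a factor `2π`.
  have himage : (fun r : ℝ => c + p * r ^ 2) '' Set.Ioi 0 = Set.Ioi c := by
    ext v
    simp only [Set.mem_image, Set.mem_Ioi]
    constructor
    · rintro ⟨r, hr, rfl⟩
      have : 0 < p * r ^ 2 := by positivity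
      linarith
    · intro hv
      have : 0 < (v - c) / p := div_pos (by linarith) hp
      refine ⟨√((v - c) / p), Real.sqrt_pos.2 this, ?_⟩
      rw [Real.sq_sqrt this.le]
      field_simp
      ring
  rw [← himage, lintegral_image_eq_lintegral_abs_deriv_mul measurableSet_Ioi
    (f' := fun r => 2 * p * r)]
  rotate_left
  · intro r _
    have := (((hasDerivAt_pow 2 r).const_mul p).const_add c).hasDerivWithinAt (s := Set.Ioi 0)
    refine this.congr_deriv ?_
    simp only [Nat.cast_ofNat, Nat.add_one_sub_one, pow_one]
    ring
  · intro r hr s hs hrs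
    have h1 : r ^ 2 = s ^ 2 := mul_left_cancel₀ hp.ne' (add_left_cancel hrs)
    exact (pow_left_inj₀ (le_of_lt hr) (le_of_lt hs) two_ne_zero).1 h1
  rw [polarCoord_target, Measure.volume_eq_prod, ← Measure.prod_restrict,
    lintegral_prod _ (Measurable.aemeasurable ?_)]
  · refine setLIntegral_congr_fun measurableSet_Ioi fun r hr => ?_
    have hr : 0 < r := hr
    simp only [smul_eq_mul, Pi.mul_apply, Complex.norm_polarCoord_symm, complexGaussianPDF,
      abs_of_pos hr]
    rw [lintegral_const, Measure.restrict_apply_univ, Real.volume_Ioo, ← mul_assoc, ← mul_assoc,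
      mul_right_comm, ← ENNReal.ofReal_mul hr.le, ← ENNReal.ofReal_mul (by positivity),
      ← ENNReal.ofReal_mul (by positivity), abs_of_pos (by positivity)]
    congr 2
    rw [show -(c + p * r ^ 2 - c) / (p * l) = -r ^ 2 / l by field_simp; ring]
    field_simp
    ring
  · have := measurable_complexGaussianPDF l
    have h1 : Measurable fun a : ℝ × ℝ => Complex.polarCoord.symm a := by
      simp only [Complex.polarCoord_symm_apply]
      fun_prop
    simp only [Pi.mul_apply, smul_eq_mul]
    fun_prop

theorem integrable_sq_gaussianReal (v : ℝ≥0) : Integrable (fun x => x ^ 2) (gaussianReal 0 v) :=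
  (memLp_id_gaussianReal 2).integrable_sq

theorem integral_sq_gaussianReal (v : ℝ≥0) : ∫ x, x ^ 2 ∂gaussianReal 0 v = v := by
  have := variance_fun_id_gaussianReal (μ := 0) (v := v)
  rw [variance_eq_integral (by fun_prop)] at this
  simpa using this

theorem integrable_sq_norm_complexGaussian (v : ℝ≥0) :
    Integrable (fun z => ‖z‖ ^ 2) (complexGaussian v) := by
  rw [complexGaussian, integrable_map_equiv]
  have h := integrable_sq_gaussianReal (v / 2)
  refine ((h.comp_fst (gaussianReal 0 (v / 2))).add
    (h.comp_snd (gaussianReal 0 (v / 2)))).congr (ae_of_all _ fun p => ?_)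
  exact (sq_norm_measurableEquivRealProd_symm p).symm

theorem integral_sq_norm_complexGaussian (v : ℝ≥0) :
    ∫ z, ‖z‖ ^ 2 ∂complexGaussian v = v := by
  rw [complexGaussian, integral_map_equiv]
  have h := integrable_sq_gaussianReal (v / 2)
  simp_rw [sq_norm_measurableEquivRealProd_symm]
  rw [integral_add (h.comp_fst _) (h.comp_snd _), integral_fun_fst (fun x : ℝ => x ^ 2),
    integral_fun_snd (fun x : ℝ => x ^ 2), integral_sq_gaussianReal]
  simp

/-! ### Threshold detectors for an arbitrary statistic -/

section Threshold

variable {X : Type} [MeasurableSpace X]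

theorem Detector.integrable_decide (d : Detector X) (P : Measure X) [IsFiniteMeasure P] :
    Integrable d.decide P :=
  Integrable.of_mem_Icc 0 1 d.measurable_decide.aemeasurable (ae_of_all _ d.decide_mem)

/-- The trade-off inequality behind the Neyman–Pearson lemma: if `P₁` dominates `k • P₀` where the
statistic exceeds the threshold and is dominated by it elsewhere, then no detector improves on the
threshold detector. -/
theorem thresholdDetector_tradeoff (P₀ P₁ : Measure X) [IsFiniteMeasure P₀] [IsFiniteMeasure P₁]
    (T : X → ℝ) (hT : Measurable T) (τ : ℝ) {k : ℝ≥0}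
    (hgt : ∀ A ⊆ {y | τ < T y}, MeasurableSet A → k * P₀ A ≤ P₁ A)
    (hle : ∀ A ⊆ {y | T y ≤ τ}, MeasurableSet A → P₁ A ≤ k * P₀ A) (d : Detector X) :
    (k : ℝ) * (∫ y, (thresholdDetector T hT τ).decide y ∂P₀ - ∫ y, d.decide y ∂P₀) ≤
      ∫ y, (thresholdDetector T hT τ).decide y ∂P₁ - ∫ y, d.decide y ∂P₁ := by
  set D := {y | τ < T y}
  have hD : MeasurableSet D := measurableSet_lt measurable_const hT
  have hDc : Dᶜ = {y | T y ≤ τ} := by ext y; simp [D]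
  -- The threshold rule is the indicator of `D`, so it exceeds `d` by `1 - d` on `D` and by `-d` off
  -- `D`; each sign is then matched with one domination hypothesis.
  have split : ∀ (P : Measure X) [IsFiniteMeasure P],
      ∫ y, (thresholdDetector T hT τ).decide y ∂P - ∫ y, d.decide y ∂P =
        ∫ y in D, (1 - d.decide y) ∂P - ∫ y in Dᶜ, d.decide y ∂P := by
    intro P _
    have hi := (thresholdDetector T hT τ).integrable_decide P
    have hd := d.integrable_decide P
    have h := integral_add_compl hD (hi.sub hd)
    simp only [Pi.sub_apply] at h
    rw [← integral_sub hi hd, ← h, sub_eq_add_neg (∫ y in D, _ ∂P),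
      ← integral_neg]
    congr 1
    · refine setIntegral_congr_fun hD fun y hy => ?_
      have hy : τ < T y := hy
      simp [thresholdDetector, hy]
    · refine setIntegral_congr_fun hD.compl fun y hy => ?_
      have hy : ¬ τ < T y := hy
      simp [thresholdDetector, hy]
  have hrgt : k • P₀.restrict D ≤ P₁.restrict D := by
    refine Measure.le_iff.2 fun A hA => ?_
    rw [Measure.smul_apply, Measure.restrict_apply hA, Measure.restrict_apply hA]
    exact hgt _ Set.inter_subset_right (hA.inter hD)
  have hrle : P₁.restrict Dᶜ ≤ k • P₀.restrict Dᶜ := by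
    refine Measure.le_iff.2 fun A hA => ?_
    rw [Measure.smul_apply, Measure.restrict_apply hA, Measure.restrict_apply hA]
    exact hle _ (Set.inter_subset_right.trans hDc.subset) (hA.inter hD.compl)
  have h1 := integral_mono_measure hrgt (f := fun y => 1 - d.decide y)
    (ae_of_all _ fun y => sub_nonneg.2 (d.decide_mem y).2)
    ((integrable_const _).sub (d.integrable_decide _))
  have h2 := integral_mono_measure hrle (f := d.decide)
    (ae_of_all _ fun y => (d.decide_mem y).1) (d.integrable_decide _)
  rw [integral_smul_nnreal_measure, NNReal.smul_def, smul_eq_mul] at h1 h2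
  rw [split P₀, split P₁]
  linarith

/-- Convergence of the probabilities that a statistic exceeds a threshold. -/
theorem tendsto_integral_thresholdDetector {ι : Type*} {l : Filter ι} [l.IsCountablyGenerated]
    (P : Measure X) [IsFiniteMeasure P] {T : ι → X → ℝ} (hT : ∀ i, Measurable (T i))
    {T' : X → ℝ} (hT' : Measurable T') {a : ι → ℝ} {a' : ℝ}
    (hlim : ∀ᵐ y ∂P, Tendsto (fun i => T i y) l (𝓝 (T' y))) (ha : Tendsto a l (𝓝 a'))
    (hatom : P {y | T' y = a'} = 0) :
    Tendsto (fun i => ∫ y, (thresholdDetector (T i) (hT i) (a i)).decide y ∂P) l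
      (𝓝 (∫ y, (thresholdDetector T' hT' a').decide y ∂P)) := by
  refine tendsto_integral_filter_of_dominated_convergence (fun _ => 1)
    (Eventually.of_forall fun i => (Detector.measurable_decide _).aestronglyMeasurable)
    (Eventually.of_forall fun i => ae_of_all _ fun y => ?_) (integrable_const _) ?_
  · have := Detector.decide_mem (thresholdDetector (T i) (hT i) (a i)) y
    rw [Real.norm_eq_abs, abs_of_nonneg this.1]
    exact this.2
  -- Off the null set `T' = a'` the limit comparison is strict, so the decisions are eventually
  -- constant.
  · have hne : ∀ᵐ y ∂P, T' y ≠ a' := by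
      simpa [ae_iff] using hatom
    filter_upwards [hlim, hne] with y hy hya
    refine tendsto_nhds_of_eventually_eq ?_
    rcases lt_or_gt_of_ne hya with h | h
    · filter_upwards [hy.eventually_lt ha h] with i hi
      simp [thresholdDetector, hi.not_gt, h.not_gt]
    · filter_upwards [ha.eventually_lt hy h] with i hi
      simp [thresholdDetector, hi, h]

theorem continuous_integral_thresholdDetector (P : Measure X) [IsFiniteMeasure P] {T : X → ℝ}
    (hT : Measurable T) (hatom : ∀ a, P {y | T y = a} = 0) :
    Continuous fun τ => ∫ y, (thresholdDetector T hT τ).decide y ∂P :=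
  continuous_iff_continuousAt.2 fun a =>
    tendsto_integral_thresholdDetector P (fun _ => hT) hT
      (ae_of_all _ fun _ => tendsto_const_nhds) tendsto_id (hatom a)

/-- Intermediate value theorem: the probability is continuous in the threshold, equals `1` at `b`
and tends to `0` at infinity. The value `0` need not be attained, hence the half-open interval. -/
theorem exists_integral_thresholdDetector_eq (P : Measure X) [IsProbabilityMeasure P] {T : X → ℝ}
    (hT : Measurable T) (hatom : ∀ a, P {y | T y = a} = 0) {b : ℝ} (hb : ∀ᵐ y ∂P, b < T y)
    {α : ℝ} (hα : α ∈ Set.Ioc (0 : ℝ) 1) :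
    ∃ τ, ∫ y, (thresholdDetector T hT τ).decide y ∂P = α := by
  have hcont := continuous_integral_thresholdDetector P hT hatom
  have htop : Tendsto (fun τ => ∫ y, (thresholdDetector T hT τ).decide y ∂P) atTop (𝓝 0) := by
    rw [← integral_zero X ℝ (μ := P)]
    refine tendsto_integral_filter_of_dominated_convergence (fun _ => 1)
      (Eventually.of_forall fun i => (Detector.measurable_decide _).aestronglyMeasurable)
      (Eventually.of_forall fun i => ae_of_all _ fun y => ?_) (integrable_const _)
      (ae_of_all _ fun y => tendsto_nhds_of_eventually_eq ?_)
    · have := Detector.decide_mem (thresholdDetector T hT i) y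
      rw [Real.norm_eq_abs, abs_of_nonneg this.1]
      exact this.2
    · filter_upwards [eventually_ge_atTop (T y)] with τ hτ
      simp [thresholdDetector, hτ]
  have hone : ∫ y, (thresholdDetector T hT b).decide y ∂P = 1 := by
    rw [integral_congr_ae (g := fun _ => (1 : ℝ))]
    · simp
    · filter_upwards [hb] with y hy
      simp [thresholdDetector, hy]
  obtain ⟨c, hcb, hc⟩ := ((eventually_ge_atTop b).and (htop.eventually_lt_const hα.1)).exists
  obtain ⟨τ, -, hτ⟩ := intermediate_value_Icc' hcb hcont.continuousOn
    (show α ∈ Set.Icc _ _ from ⟨hc.le, hα.2.trans hone.ge⟩)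
  exact ⟨τ, hτ⟩

end Threshold

/-! ### The random variance and its likelihood ratio -/

/-- The law of independent `CN(0, v)` symbols with indices in `ι`. -/
def symbolKernel (ι : Type) : Kernel ℝ (ι → ℂ) where
  toFun v := Measure.infinitePi fun _ : ι => complexGaussian v.toNNReal
  measurable' := by
    refine Measurable.measure_of_isPiSystem_of_isProbabilityMeasure
      (generateFrom_squareCylinders (α := fun _ : ι => ℂ)).symm
      (isPiSystem_squareCylinders (fun _ => MeasurableSpace.isPiSystem_measurableSet)
        (fun _ => Set.mem_ofPred.mpr MeasurableSet.univ)) ?_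
    rintro _ ⟨s, t, ht, rfl⟩
    have ht' : ∀ i ∈ s, MeasurableSet (t i) := fun i _ => ht i (Set.mem_univ i)
    simp only [Measure.infinitePi_pi _ ht']
    refine Finset.measurable_prod _ fun i hi => ?_
    exact (Measure.measurable_coe (ht' i hi)).comp
      (measurable_complexGaussian.comp measurable_real_toNNReal)

theorem symbolKernel_apply (ι : Type) (v : ℝ) :
    symbolKernel ι v = Measure.infinitePi fun _ : ι => complexGaussian v.toNNReal := rfl

instance isMarkovKernel_symbolKernel (ι : Type) : IsMarkovKernel (symbolKernel ι) :=
  ⟨fun v => by rw [symbolKernel_apply]; infer_instance⟩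

theorem symbolKernel_map_of_injective {ι κ : Type} {f : κ → ι} (hf : Function.Injective f)
    (v : ℝ) :
    (symbolKernel ι v).map (fun y i => y (f i)) = symbolKernel κ v :=
  Measure.map_infinitePi_infinitePi_of_inj hf

namespace Slot

variable (S : Slot)

theorem receivedKernel_apply (ι : Type) (q : Hypothesis) (h : ℂ) :
    S.receivedKernel ι q h = symbolKernel ι (S.variance q h) := rfl

/-- The smallest possible variance of a received symbol. -/
def baseVariance (q : Hypothesis) : ℝ :=
  S.PS * S.gainSD + S.relayPower q * S.gainRD + S.noise

/-- The mean excess of the variance of a received symbol over its smallest possible value. -/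
def excessMean (q : Hypothesis) : ℝ := S.relayPower q * (S.β * S.ΩRD)

/-- The law of the random variance of the received symbols. -/
def varianceLaw (q : Hypothesis) : Measure ℝ := S.errorLaw.map (S.variance q)

/-- The density of the variance of the received symbols, above its smallest value. -/
def varianceDensity (q : Hypothesis) (v : ℝ) : ℝ :=
  (S.excessMean q)⁻¹ * Real.exp (-(v - S.baseVariance q) / S.excessMean q)

/-- The likelihood ratio of the variances of the received symbols. -/
def varianceRatio (v : ℝ) : ℝ :=
  if S.baseVariance .H1 < v then S.varianceDensity .H1 v / S.varianceDensity .H0 v else 0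

theorem relayPower_pos (q : Hypothesis) : 0 < S.relayPower q := by
  have := S.PR_pos
  have := S.PΔ_pos
  cases q <;> simp only [relayPower] <;> linarith

theorem relayPower_lt : S.relayPower .H0 < S.relayPower .H1 := by
  have := S.PΔ_pos
  simp only [relayPower]
  linarith

theorem errorVariance_pos : 0 < S.β * S.ΩRD := mul_pos S.β_mem.1 S.ΩRD_pos

theorem excessMean_pos (q : Hypothesis) : 0 < S.excessMean q :=
  mul_pos (S.relayPower_pos q) S.errorVariance_pos

theorem excessMean_lt : S.excessMean .H0 < S.excessMean .H1 :=
  mul_lt_mul_of_pos_right S.relayPower_lt S.errorVariance_pos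

theorem noise_le_baseVariance (q : Hypothesis) : S.noise ≤ S.baseVariance q := by
  have h1 := mul_nonneg S.PS_pos.le S.gainSD_nonneg
  have h2 := mul_nonneg (S.relayPower_pos q).le S.gainRD_nonneg
  unfold baseVariance
  linarith

theorem baseVariance_le : S.baseVariance .H0 ≤ S.baseVariance .H1 := by
  have := mul_le_mul_of_nonneg_right S.relayPower_lt.le S.gainRD_nonneg
  unfold baseVariance
  linarith

theorem noise_le_variance (q : Hypothesis) (h : ℂ) : S.noise ≤ S.variance q h := by
  have h1 := S.noise_le_baseVariance q
  have h2 := mul_nonneg (S.relayPower_pos q).le (sq_nonneg ‖h‖)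
  unfold baseVariance at h1
  unfold variance
  linarith

theorem variance_pos (q : Hypothesis) (h : ℂ) : 0 < S.variance q h :=
  S.noise_pos.trans_le (S.noise_le_variance q h)

instance isProbabilityMeasure_errorLaw : IsProbabilityMeasure S.errorLaw :=
  isProbabilityMeasure_complexGaussian _

instance isProbabilityMeasure_varianceLaw (q : Hypothesis) :
    IsProbabilityMeasure (S.varianceLaw q) :=
  Measure.isProbabilityMeasure_map (S.measurable_variance q).aemeasurable

theorem ae_noise_le_varianceLaw (q : Hypothesis) : ∀ᵐ v ∂S.varianceLaw q, S.noise ≤ v :=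
  (ae_map_iff (S.measurable_variance q).aemeasurable measurableSet_Ici).2
    (ae_of_all _ (S.noise_le_variance q))

theorem receivedLaw_eq_bind (ι : Type) (q : Hypothesis) :
    S.receivedLaw ι q = (S.varianceLaw q).bind (symbolKernel ι) := by
  ext A hA
  rw [receivedLaw, varianceLaw, Measure.bind_apply hA (Kernel.aemeasurable _),
    Measure.bind_apply hA (Kernel.aemeasurable _),
    lintegral_map (Kernel.measurable_coe _ hA) (S.measurable_variance q)]
  rfl

theorem receivedLaw_apply (ι : Type) (q : Hypothesis) {A : Set (ι → ℂ)} (hA : MeasurableSet A) :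
    S.receivedLaw ι q A = ∫⁻ v, symbolKernel ι v A ∂S.varianceLaw q := by
  rw [receivedLaw_eq_bind, Measure.bind_apply hA (Kernel.aemeasurable _)]

instance isProbabilityMeasure_receivedLaw (ι : Type) (q : Hypothesis) :
    IsProbabilityMeasure (S.receivedLaw ι q) :=
  ⟨by simp [S.receivedLaw_apply ι q MeasurableSet.univ]⟩

/-- Lets a block of `n` symbols be read as the start of an infinite sequence, so that all
blocklengths share one probability space. -/
theorem receivedLaw_map_of_injective {ι κ : Type} {f : κ → ι} (hf : Function.Injective f)
    (q : Hypothesis) :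
    (S.receivedLaw ι q).map (fun y i => y (f i)) = S.receivedLaw κ q := by
  have hmeas : Measurable fun (y : ι → ℂ) i => y (f i) := by fun_prop
  ext A hA
  rw [Measure.map_apply hmeas hA, S.receivedLaw_apply _ q (hmeas hA), S.receivedLaw_apply _ q hA]
  refine lintegral_congr fun v => ?_
  rw [← symbolKernel_map_of_injective hf, Measure.map_apply hmeas hA]

theorem measurable_varianceDensity (q : Hypothesis) : Measurable (S.varianceDensity q) := by
  unfold varianceDensity
  fun_prop

theorem varianceDensity_pos (q : Hypothesis) (v : ℝ) : 0 < S.varianceDensity q v :=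
  mul_pos (inv_pos.2 (S.excessMean_pos q)) (Real.exp_pos _)

theorem varianceLaw_eq_withDensity (q : Hypothesis) :
    S.varianceLaw q = (volume.restrict (Set.Ioi (S.baseVariance q))).withDensity
      fun v => ENNReal.ofReal (S.varianceDensity q v) := by
  ext A hA
  rw [varianceLaw, ← lintegral_indicator_one hA, ← lintegral_indicator_one hA,
    lintegral_map (measurable_one.indicator hA) (S.measurable_variance q),
    lintegral_withDensity_eq_lintegral_mul _ (S.measurable_varianceDensity q).ennreal_ofReal
      (measurable_one.indicator hA)]
  have := lintegral_affine_sq_norm_complexGaussian S.errorVariance_pos (S.relayPower_pos q)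
    (c := S.baseVariance q) (A.indicator 1) (measurable_one.indicator hA)
  refine Eq.trans (lintegral_congr fun h => ?_) this
  congr 1
  unfold variance baseVariance
  ring

theorem varianceRatio_eq (v : ℝ) : S.varianceDensity .H1 v / S.varianceDensity .H0 v =
    S.excessMean .H0 / S.excessMean .H1 *
      Real.exp ((v - S.baseVariance .H0) / S.excessMean .H0 -
        (v - S.baseVariance .H1) / S.excessMean .H1) := by
  have h0 := S.excessMean_pos .H0
  have h1 := S.excessMean_pos .H1
  rw [varianceDensity, varianceDensity, mul_div_mul_comm, ← Real.exp_sub, inv_div_inv]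
  congr 2
  ring

/-- The exponent is affine in `v` with slope `1 / excessMean .H0 - 1 / excessMean .H1`, positive by
`excessMean_lt`. -/
theorem strictMono_varianceDensity_div :
    StrictMono fun v => S.varianceDensity .H1 v / S.varianceDensity .H0 v := by
  intro v w hvw
  have h0 := S.excessMean_pos .H0
  have h1 := S.excessMean_pos .H1
  simp only [varianceRatio_eq]
  refine mul_lt_mul_of_pos_left (Real.exp_lt_exp.2 ?_) (div_pos h0 h1)
  have : (w - v) / S.excessMean .H1 < (w - v) / S.excessMean .H0 :=
    div_lt_div_of_pos_left (by linarith) h0 S.excessMean_lt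
  simp only [sub_div] at this ⊢
  linarith

theorem varianceRatio_nonneg (v : ℝ) : 0 ≤ S.varianceRatio v := by
  unfold varianceRatio
  split_ifs
  · exact (div_pos (S.varianceDensity_pos _ _) (S.varianceDensity_pos _ _)).le
  · exact le_rfl

theorem monotone_varianceRatio : Monotone S.varianceRatio := by
  intro v w hvw
  by_cases hv : S.baseVariance .H1 < v
  · rw [varianceRatio, varianceRatio, if_pos hv, if_pos (hv.trans_le hvw)]
    exact S.strictMono_varianceDensity_div.monotone hvw
  · rw [varianceRatio, if_neg hv]
    exact S.varianceRatio_nonneg w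

/-- The likelihood ratio of the variances crosses `1`. -/
theorem exists_varianceRatio_threshold :
    ∃ τ, (∀ v, τ < v → 1 ≤ S.varianceRatio v) ∧ ∀ v ≤ τ, S.varianceRatio v ≤ 1 := by
  have h0 := S.excessMean_pos .H0
  have h1 := S.excessMean_pos .H1
  obtain ⟨w, hw⟩ : ∃ w, S.varianceDensity .H1 w / S.varianceDensity .H0 w = 1 := by
    have hd : (S.excessMean .H0)⁻¹ - (S.excessMean .H1)⁻¹ ≠ 0 :=
      (sub_pos.2 (inv_strictAnti₀ h0 S.excessMean_lt)).ne'
    -- Solution of the linear equation that sets the exponent in `varianceRatio_eq` equal to `log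
    -- (excessMean .H1 / excessMean .H0)`, cancelling the prefactor.
    refine ⟨(Real.log (S.excessMean .H1 / S.excessMean .H0) +
      S.baseVariance .H0 / S.excessMean .H0 - S.baseVariance .H1 / S.excessMean .H1) /
      ((S.excessMean .H0)⁻¹ - (S.excessMean .H1)⁻¹), ?_⟩
    rw [varianceRatio_eq]
    set w := _ / ((S.excessMean .H0)⁻¹ - (S.excessMean .H1)⁻¹) with hw
    have hexp : (w - S.baseVariance .H0) / S.excessMean .H0 -
        (w - S.baseVariance .H1) / S.excessMean .H1 =
          Real.log (S.excessMean .H1 / S.excessMean .H0) := by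
      have := (eq_div_iff hd).1 hw
      simp only [sub_div]
      simp only [mul_sub, ← div_eq_mul_inv] at this
      linarith
    rw [hexp, Real.exp_log (div_pos h1 h0)]
    field_simp
  -- If the densities cross before `baseVariance .H1`, the ratio passes `1` by its jump there from
  -- the value `0`.
  refine ⟨max (S.baseVariance .H1) w, fun v hv => ?_, fun v hv => ?_⟩
  · rw [varianceRatio, if_pos ((le_max_left _ _).trans_lt hv), ← hw]
    exact S.strictMono_varianceDensity_div.monotone ((le_max_right _ _).trans hv.le)
  · by_cases hc : S.baseVariance .H1 < v
    · rw [varianceRatio, if_pos hc, ← hw]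
      exact S.strictMono_varianceDensity_div.monotone ((le_max_iff.1 hv).resolve_left hc.not_ge)
    · rw [varianceRatio, if_neg hc]
      exact zero_le_one

/-- Absolute continuity rests on `baseVariance_le`: the support under `H1` is contained in the one
under `H0`. -/
theorem varianceLaw_H1_eq_withDensity :
    S.varianceLaw .H1 =
      (S.varianceLaw .H0).withDensity fun v => ENNReal.ofReal (S.varianceRatio v) := by
  have hm : Measurable fun v => ENNReal.ofReal (S.varianceRatio v) :=
    S.monotone_varianceRatio.measurable.ennreal_ofReal
  rw [varianceLaw_eq_withDensity, varianceLaw_eq_withDensity,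
    ← withDensity_mul _ (S.measurable_varianceDensity _).ennreal_ofReal hm,
    ← withDensity_indicator measurableSet_Ioi, ← withDensity_indicator measurableSet_Ioi]
  congr 1
  ext v
  have h0 := S.varianceDensity_pos .H0 v
  have h1 := S.varianceDensity_pos .H1 v
  by_cases hv : S.baseVariance .H1 < v
  · rw [Set.indicator_of_mem (Set.mem_Ioi.2 hv),
      Set.indicator_of_mem (Set.mem_Ioi.2 (S.baseVariance_le.trans_lt hv)), Pi.mul_apply,
      ← ENNReal.ofReal_mul h0.le, varianceRatio, if_pos hv, mul_div_cancel₀ _ h0.ne']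
  · rw [Set.indicator_of_notMem (by simpa using hv)]
    simp [Set.indicator_apply, varianceRatio, hv]

theorem varianceLaw_singleton (q : Hypothesis) (a : ℝ) : S.varianceLaw q {a} = 0 := by
  rw [varianceLaw_eq_withDensity]
  exact withDensity_absolutelyContinuous _ _ (by simp)

theorem missedDetection_eq_one_sub {ι : Type} (d : Detector (ι → ℂ)) :
    S.missedDetection d = 1 - ∫ y, d.decide y ∂S.receivedLaw ι .H1 := by
  rw [missedDetection, integral_sub (integrable_const _) (d.integrable_decide _)]
  simp

/-- Neyman–Pearson: a competitor with no larger false alarm makes the left side of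
`thresholdDetector_tradeoff` nonnegative, as `k` is. -/
theorem mostPowerful_thresholdDetector {ι : Type} {T : (ι → ℂ) → ℝ} (hT : Measurable T) {τ : ℝ}
    {k : ℝ≥0}
    (hgt : ∀ A ⊆ {y | τ < T y}, MeasurableSet A →
      k * S.receivedLaw ι .H0 A ≤ S.receivedLaw ι .H1 A)
    (hle : ∀ A ⊆ {y | T y ≤ τ}, MeasurableSet A →
      S.receivedLaw ι .H1 A ≤ k * S.receivedLaw ι .H0 A) :
    S.MostPowerful (thresholdDetector T hT τ) := by
  intro d hd
  have h := thresholdDetector_tradeoff _ _ T hT τ hgt hle d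
  have h' := mul_nonneg k.coe_nonneg (sub_nonneg.2 hd)
  rw [S.missedDetection_eq_one_sub, S.missedDetection_eq_one_sub]
  unfold falseAlarm at h'
  linarith

theorem minimizesError_thresholdDetector {ι : Type} {T : (ι → ℂ) → ℝ} (hT : Measurable T) {τ : ℝ}
    (hgt : ∀ A ⊆ {y | τ < T y}, MeasurableSet A → S.receivedLaw ι .H0 A ≤ S.receivedLaw ι .H1 A)
    (hle : ∀ A ⊆ {y | T y ≤ τ}, MeasurableSet A →
      S.receivedLaw ι .H1 A ≤ S.receivedLaw ι .H0 A) :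
    S.MinimizesError (thresholdDetector T hT τ) := by
  intro d
  have h := thresholdDetector_tradeoff (S.receivedLaw ι .H0) (S.receivedLaw ι .H1) T hT τ (k := 1)
    (by simpa using hgt) (by simpa using hle) d
  rw [detectionError, detectionError, S.missedDetection_eq_one_sub, S.missedDetection_eq_one_sub,
    falseAlarm, falseAlarm]
  rw [NNReal.coe_one, one_mul] at h
  linarith

end Slot

/-! ### Infinite blocklength: the limit power reveals the variance -/

theorem ae_tendsto_partialPower {v : ℝ} (hv : 0 ≤ v) :
    ∀ᵐ y ∂symbolKernel ℕ v, Tendsto (partialPower y) atTop (𝓝 v) := by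
  set P := symbolKernel ℕ v
  have heval : ∀ i : ℕ, MeasurePreserving (fun y : ℕ → ℂ => y i) P (complexGaussian v.toNNReal) :=
    measurePreserving_eval_infinitePi fun _ : ℕ => complexGaussian v.toNNReal
  have hmeas : Measurable fun z : ℂ => ‖z‖ ^ 2 := by fun_prop
  have hind : iIndepFun (fun i (y : ℕ → ℂ) => ‖y i‖ ^ 2) P :=
    iIndepFun_infinitePi (P := fun _ : ℕ => complexGaussian v.toNNReal)
      (X := fun _ z => ‖z‖ ^ 2) fun _ => hmeas
  have hint : Integrable (fun y : ℕ → ℂ => ‖y 0‖ ^ 2) P :=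
    (heval 0).integrable_comp_of_integrable (integrable_sq_norm_complexGaussian v.toNNReal)
  have hmean : ∫ y, ‖y 0‖ ^ 2 ∂P = v := by
    have := integral_map (μ := P) (heval 0).measurable.aemeasurable (f := fun z : ℂ => ‖z‖ ^ 2)
      hmeas.aestronglyMeasurable
    rw [← this, (heval 0).map_eq, integral_sq_norm_complexGaussian, Real.coe_toNNReal v hv]
  have hident : ∀ i, IdentDistrib (fun y : ℕ → ℂ => ‖y i‖ ^ 2) (fun y => ‖y 0‖ ^ 2) P P := by
    intro i
    have : IdentDistrib (fun y : ℕ → ℂ => y i) (fun y => y 0) P P :=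
      ⟨(heval i).measurable.aemeasurable, (heval 0).measurable.aemeasurable,
        (heval i).map_eq.trans (heval 0).map_eq.symm⟩
    exact this.comp hmeas
  filter_upwards [strong_law_ae_real _ hint (fun i j hij => hind.indepFun hij) hident] with y hy
  rw [hmean] at hy
  refine hy.congr fun n => ?_
  rw [partialPower, averagePower, Finset.sum_range]

theorem ae_limitPower_eq {v : ℝ} (hv : 0 ≤ v) : ∀ᵐ y ∂symbolKernel ℕ v, limitPower y = v := by
  filter_upwards [ae_tendsto_partialPower hv] with y hy
  exact hy.limUnder_eq

/-- Sequences with different variances have mutually singular laws, separated by `limitPower`. This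
reduces detection from a sequence to detection from `v`. -/
theorem symbolKernel_eq_zero {v : ℝ} (hv : 0 ≤ v) {A : Set (ℕ → ℂ)}
    (hA : ∀ y ∈ A, limitPower y ≠ v) : symbolKernel ℕ v A = 0 := by
  have h := ae_limitPower_eq hv
  rw [ae_iff] at h
  exact measure_mono_null hA h

theorem measurable_partialPower (n : ℕ) : Measurable fun y => partialPower y n :=
  (measurable_averagePower n).comp (by fun_prop)

namespace Slot

variable (S : Slot)

theorem ae_receivedLaw_of_ae {ι : Type} (q : Hypothesis) {p : (ι → ℂ) → Prop}
    (hp : MeasurableSet {y | p y})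
    (h : ∀ᵐ v ∂S.varianceLaw q, ∀ᵐ y ∂symbolKernel ι v, p y) : ∀ᵐ y ∂S.receivedLaw ι q, p y := by
  change S.receivedLaw ι q {y | p y}ᶜ = 0
  rw [S.receivedLaw_apply ι q hp.compl, lintegral_eq_zero_iff
    (Kernel.measurable_coe _ hp.compl)]
  exact h

theorem ae_varianceLaw_nonneg (q : Hypothesis) : ∀ᵐ v ∂S.varianceLaw q, 0 ≤ v := by
  filter_upwards [S.ae_noise_le_varianceLaw q] with v hv
  exact S.noise_pos.le.trans hv

/-- Given `v`, the event `limitPower ∈ B` has probability `1` or `0` according to whether `v ∈ B`.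
-/
theorem receivedLaw_map_limitPower (q : Hypothesis) :
    (S.receivedLaw ℕ q).map limitPower = S.varianceLaw q := by
  ext B hB
  rw [Measure.map_apply measurable_limitPower hB,
    S.receivedLaw_apply _ _ (measurable_limitPower hB), ← lintegral_indicator_one hB]
  refine lintegral_congr_ae ?_
  filter_upwards [S.ae_varianceLaw_nonneg q] with v hv
  by_cases hvB : v ∈ B
  · rw [Set.indicator_of_mem hvB, Pi.one_apply,
      ← prob_compl_eq_zero_iff (measurable_limitPower hB)]
    exact symbolKernel_eq_zero hv fun y hy hyv => hy (Set.mem_preimage.2 (hyv ▸ hvB))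
  · rw [Set.indicator_of_notMem hvB]
    exact symbolKernel_eq_zero hv fun y hy hyv => hvB (hyv ▸ hy)

theorem receivedLaw_limitPower_eq (q : Hypothesis) (a : ℝ) :
    S.receivedLaw ℕ q {y | limitPower y = a} = 0 := by
  rw [← S.varianceLaw_singleton q a, ← S.receivedLaw_map_limitPower,
    Measure.map_apply measurable_limitPower (measurableSet_singleton a)]
  rfl

theorem ae_tendsto_limitPower (q : Hypothesis) :
    ∀ᵐ y ∂S.receivedLaw ℕ q, Tendsto (partialPower y) atTop (𝓝 (limitPower y)) := by
  refine S.ae_receivedLaw_of_ae q ?_ ?_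
  · exact measurableSet_tendsto_fun measurable_partialPower measurable_limitPower
  · filter_upwards [S.ae_varianceLaw_nonneg q] with v hv
    filter_upwards [ae_tendsto_partialPower hv] with y hy
    rwa [limitPower, hy.limUnder_eq]

theorem integral_radiometer (q : Hypothesis) (n : ℕ) (τ : ℝ) :
    ∫ y, (radiometer n τ).decide y ∂S.receivedLaw (Fin n) q =
      ∫ y, (thresholdDetector _ (measurable_partialPower n) τ).decide y ∂S.receivedLaw ℕ q := by
  rw [← S.receivedLaw_map_of_injective (f := (Fin.val : Fin n → ℕ)) Fin.val_injective,
    integral_map (Measurable.aemeasurable (by fun_prop))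
      (Detector.measurable_decide _).aestronglyMeasurable]
  rfl

theorem tendsto_integral_radiometer (q : Hypothesis) (τ : ℝ) :
    Tendsto (fun n => ∫ y, (radiometer n τ).decide y ∂S.receivedLaw (Fin n) q) atTop
      (𝓝 (∫ y, (limitRadiometer τ).decide y ∂S.receivedLaw ℕ q)) := by
  simp only [integral_radiometer]
  exact tendsto_integral_thresholdDetector _ measurable_partialPower measurable_limitPower
    (S.ae_tendsto_limitPower q) tendsto_const_nhds (S.receivedLaw_limitPower_eq q τ)

theorem receivedLaw_H1_apply {ι : Type} {A : Set (ι → ℂ)} (hA : MeasurableSet A) :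
    S.receivedLaw ι .H1 A = ∫⁻ v, ENNReal.ofReal (S.varianceRatio v) * symbolKernel ι v A
      ∂S.varianceLaw .H0 := by
  rw [S.receivedLaw_apply _ _ hA, S.varianceLaw_H1_eq_withDensity,
    lintegral_withDensity_eq_lintegral_mul _ S.monotone_varianceRatio.measurable.ennreal_ofReal
      (Kernel.measurable_coe _ hA)]
  rfl

/-- Variances `v ≤ τ` give `A` no mass, so the bound on the ratio is needed only for `v > τ`. -/
theorem mul_receivedLaw_le {τ k : ℝ} (h : ∀ v, τ < v → k ≤ S.varianceRatio v) {A : Set (ℕ → ℂ)}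
    (hA : A ⊆ {y | τ < limitPower y}) (hAm : MeasurableSet A) :
    ENNReal.ofReal k * S.receivedLaw ℕ .H0 A ≤ S.receivedLaw ℕ .H1 A := by
  rw [S.receivedLaw_H1_apply hAm, S.receivedLaw_apply _ _ hAm,
    ← lintegral_const_mul _ (Kernel.measurable_coe _ hAm)]
  refine lintegral_mono_ae ?_
  filter_upwards [S.ae_varianceLaw_nonneg .H0] with v hv
  by_cases hvτ : τ < v
  · gcongr
    exact h v hvτ
  · have : symbolKernel ℕ v A = 0 := symbolKernel_eq_zero hv fun y hy hyv => hvτ (hyv ▸ hA hy)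
    simp [this]

theorem receivedLaw_le_mul {τ k : ℝ} (h : ∀ v ≤ τ, S.varianceRatio v ≤ k) {A : Set (ℕ → ℂ)}
    (hA : A ⊆ {y | limitPower y ≤ τ}) (hAm : MeasurableSet A) :
    S.receivedLaw ℕ .H1 A ≤ ENNReal.ofReal k * S.receivedLaw ℕ .H0 A := by
  rw [S.receivedLaw_H1_apply hAm, S.receivedLaw_apply _ _ hAm,
    ← lintegral_const_mul _ (Kernel.measurable_coe _ hAm)]
  refine lintegral_mono_ae ?_
  filter_upwards [S.ae_varianceLaw_nonneg .H0] with v hv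
  by_cases hvτ : v ≤ τ
  · gcongr
    exact h v hvτ
  · have : symbolKernel ℕ v A = 0 := symbolKernel_eq_zero hv fun y hy hyv => hvτ (hyv ▸ hA hy)
    simp [this]

theorem mostPowerful_limitRadiometer (τ : ℝ) : S.MostPowerful (limitRadiometer τ) :=
  S.mostPowerful_thresholdDetector measurable_limitPower (k := (S.varianceRatio τ).toNNReal)
    (fun _ => S.mul_receivedLaw_le fun _ hv => S.monotone_varianceRatio hv.le)
    (fun _ => S.receivedLaw_le_mul fun _ hv => S.monotone_varianceRatio hv)

theorem exists_minimizesError_limitRadiometer : ∃ τ, S.MinimizesError (limitRadiometer τ) := by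
  obtain ⟨τ, h1, h2⟩ := S.exists_varianceRatio_threshold
  refine ⟨τ, S.minimizesError_thresholdDetector measurable_limitPower (fun A hA hAm => ?_)
    (fun A hA hAm => ?_)⟩
  · simpa using S.mul_receivedLaw_le h1 hA hAm
  · simpa using S.receivedLaw_le_mul h2 hA hAm

theorem exists_falseAlarm_limitRadiometer_eq {α : ℝ} (hα : α ∈ Set.Ioc (0 : ℝ) 1) :
    ∃ τ, S.falseAlarm (limitRadiometer τ) = α := by
  refine exists_integral_thresholdDetector_eq (S.receivedLaw ℕ .H0) measurable_limitPower
    (S.receivedLaw_limitPower_eq .H0) (b := 0) ?_ hα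
  refine S.ae_receivedLaw_of_ae _ (measurableSet_lt measurable_const measurable_limitPower) ?_
  filter_upwards [S.ae_noise_le_varianceLaw .H0] with v hv
  have hv := S.noise_pos.trans_le hv
  filter_upwards [ae_limitPower_eq hv.le] with y hy
  rwa [hy]

end Slot

/-! ### Finite blocklength: densities as functions of the average power -/

theorem integral_lt_integral_of_ae_lt {X : Type*} [MeasurableSpace X] {P : Measure X} [NeZero P]
    {f g : X → ℝ} (hf : Integrable f P) (hg : Integrable g P) (h : ∀ᵐ x ∂P, f x < g x) :
    ∫ x, f x ∂P < ∫ x, g x ∂P := by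
  refine lt_of_le_of_ne (integral_mono_ae hf hg (h.mono fun x hx => hx.le)) fun heq => ?_
  have h0 := (integral_eq_iff_of_ae_le hf hg (h.mono fun x hx => hx.le)).1 heq
  obtain ⟨x, hx, hx'⟩ := (h.and h0).exists
  exact hx.ne hx'

theorem pi_withDensity_ofReal {ι : Type*} [Fintype ι] {f : ℂ → ℝ} (hf : Integrable f)
    (hf0 : ∀ z, 0 ≤ f z) :
    Measure.pi (fun _ : ι => volume.withDensity fun z => ENNReal.ofReal (f z)) =
      volume.withDensity fun y : ι → ℂ => ENNReal.ofReal (∏ i, f (y i)) := by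
  have : IsFiniteMeasure (volume.withDensity fun z => ENNReal.ofReal (f z)) :=
    isFiniteMeasure_withDensity_ofReal hf.2
  refine Measure.pi_eq fun s hs => ?_
  rw [withDensity_apply _ (MeasurableSet.univ_pi hs), volume_pi, Measure.restrict_pi_pi,
    ← ofReal_integral_eq_lintegral_ofReal (Integrable.fintype_prod fun i => hf.restrict)
      (ae_of_all _ fun y => Finset.prod_nonneg fun i _ => hf0 _),
    integral_fintype_prod_eq_prod (fun _ => f),
    ENNReal.ofReal_prod_of_nonneg fun i _ => integral_nonneg hf0]
  refine Finset.prod_congr rfl fun i _ => ?_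
  rw [withDensity_apply _ (hs i), ofReal_integral_eq_lintegral_ofReal hf.restrict
    (ae_of_all _ hf0)]

theorem integrable_complexGaussianPDF {v : ℝ} (hv : 0 < v) : Integrable (complexGaussianPDF v) := by
  refine ⟨(measurable_complexGaussianPDF v).aestronglyMeasurable, ?_⟩
  rw [hasFiniteIntegral_iff_ofReal (ae_of_all _ fun z => (complexGaussianPDF_pos hv z).le),
    ← setLIntegral_univ, ← withDensity_apply _ MeasurableSet.univ,
    ← complexGaussian_eq_withDensity hv]
  exact measure_lt_top _ _

/-- The density of `n` independent `CN(0, v)` symbols, as a function of their average power. -/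
def powerDensity (n : ℕ) (v t : ℝ) : ℝ := Real.exp (-(n * t) / v) / (Real.pi * v) ^ n

theorem prod_complexGaussianPDF {n : ℕ} (hn : 0 < n) (v : ℝ) (y : Fin n → ℂ) :
    ∏ ω, complexGaussianPDF v (y ω) = powerDensity n v (averagePower n y) := by
  have hn : (n : ℝ) ≠ 0 := by positivity
  simp only [complexGaussianPDF, powerDensity, averagePower]
  rw [Finset.prod_div_distrib, ← Real.exp_sum, Finset.prod_const, Finset.card_univ,
    Fintype.card_fin, mul_div_cancel₀ _ hn, ← Finset.sum_div, Finset.sum_neg_distrib]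

theorem symbolKernel_eq_withDensity {n : ℕ} (hn : 0 < n) {v : ℝ} (hv : 0 < v) :
    symbolKernel (Fin n) v =
      volume.withDensity fun y => ENNReal.ofReal (powerDensity n v (averagePower n y)) := by
  rw [symbolKernel_apply, Measure.infinitePi_eq_pi]
  simp_rw [complexGaussian_eq_withDensity hv, ← prod_complexGaussianPDF hn]
  exact pi_withDensity_ofReal (integrable_complexGaussianPDF hv)
    fun z => (complexGaussianPDF_pos hv z).le

theorem measurable_powerDensity (n : ℕ) :
    Measurable fun p : ℝ × ℝ => powerDensity n p.1 p.2 := by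
  unfold powerDensity
  fun_prop

theorem powerDensity_pos (n : ℕ) {v : ℝ} (hv : 0 < v) (t : ℝ) : 0 < powerDensity n v t := by
  have := Real.pi_pos
  unfold powerDensity
  positivity

/-- With `b` the noise power, this bound is uniform in `v` and `t`; it gives integrability of the
mixtures and dominates in the proof of their continuity. -/
theorem powerDensity_le (n : ℕ) {b v t : ℝ} (hb : 0 < b) (hv : b ≤ v) (ht : 0 ≤ t) :
    powerDensity n v t ≤ 1 / (Real.pi * b) ^ n := by
  have := Real.pi_pos
  have hv0 : 0 < v := hb.trans_le hv
  unfold powerDensity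
  gcongr
  rw [Real.exp_le_one_iff, neg_div, neg_nonpos]
  positivity

theorem powerDensity_eq_mul (n : ℕ) (v t t' : ℝ) :
    powerDensity n v t' = Real.exp (-(n * (t' - t)) / v) * powerDensity n v t := by
  unfold powerDensity
  rw [← mul_div_assoc, ← Real.exp_add]
  congr 2
  ring

theorem continuous_averagePower (n : ℕ) : Continuous (averagePower n) := by
  unfold averagePower
  fun_prop

theorem averagePower_nonneg (n : ℕ) (y : Fin n → ℂ) : 0 ≤ averagePower n y := by
  unfold averagePower
  positivity

theorem exists_averagePower_eq {n : ℕ} (hn : 0 < n) {t : ℝ} (ht : 0 ≤ t) :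
    ∃ y, averagePower n y = t := by
  have hn : (n : ℝ) ≠ 0 := by positivity
  refine ⟨fun _ => (√t : ℂ), ?_⟩
  simp [averagePower, Real.sq_sqrt ht, hn]

theorem volume_averagePower_eq {n : ℕ} (hn : 0 < n) (a : ℝ) :
    volume {y : Fin n → ℂ | averagePower n y = a} = 0 := by
  have : NeZero n := ⟨hn.ne'⟩
  have hn' : (n : ℝ) ≠ 0 := by positivity
  -- The level sets are spheres for the Euclidean norm, not for the sup norm of `Fin n → ℂ`; hence
  -- the transport of Lebesgue measure to a Haar measure on `EuclideanSpace`.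
  let e := (PiLp.continuousLinearEquiv 2 ℝ fun _ : Fin n => ℂ).symm
  let μ : Measure (EuclideanSpace ℂ (Fin n)) := volume.map e
  have hμ : μ.IsAddHaarMeasure := e.isAddHaarMeasure_map volume
  have h0 : μ (Metric.sphere 0 √(n * a)) = 0 := Measure.addHaar_sphere μ 0 _
  rw [Measure.map_apply e.continuous.measurable Metric.isClosed_sphere.measurableSet] at h0
  refine measure_mono_null (fun y hy => ?_) h0
  have hy : averagePower n y = a := hy
  rw [Set.mem_preimage, mem_sphere_zero_iff_norm, EuclideanSpace.norm_eq, ← hy, averagePower,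
    mul_div_cancel₀ _ hn']
  rfl

/-! ### Finite blocklength: monotone likelihood ratio and optimality -/

namespace Slot

variable (S : Slot)

/-- The density of `n` received symbols, as a function of their average power. -/
def powerMixture (n : ℕ) (q : Hypothesis) (t : ℝ) : ℝ := ∫ v, powerDensity n v t ∂S.varianceLaw q

theorem mixtureDensity_eq {n : ℕ} (hn : 0 < n) (q : Hypothesis) (y : Fin n → ℂ) :
    S.mixtureDensity q y = S.powerMixture n q (averagePower n y) := by
  have hm : Measurable fun v => powerDensity n v (averagePower n y) :=
    (measurable_powerDensity n).comp (measurable_id.prodMk measurable_const)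
  rw [powerMixture, varianceLaw, integral_map (S.measurable_variance q).aemeasurable
    hm.aestronglyMeasurable]
  simp_rw [← prod_complexGaussianPDF hn]
  rfl

theorem integrable_powerDensity (n : ℕ) (q : Hypothesis) {t : ℝ} (ht : 0 ≤ t) :
    Integrable (fun v => powerDensity n v t) (S.varianceLaw q) := by
  refine Integrable.of_bound ((measurable_powerDensity n).comp
    (measurable_id.prodMk measurable_const)).aestronglyMeasurable
      (1 / (Real.pi * S.noise) ^ n) ?_
  filter_upwards [S.ae_noise_le_varianceLaw q] with v hv
  rw [Real.norm_eq_abs, abs_of_pos (powerDensity_pos n (S.noise_pos.trans_le hv) t)]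
  exact powerDensity_le n S.noise_pos hv ht

theorem powerMixture_pos (n : ℕ) (q : Hypothesis) {t : ℝ} (ht : 0 ≤ t) :
    0 < S.powerMixture n q t := by
  rw [← integral_zero ℝ ℝ (μ := S.varianceLaw q)]
  refine integral_lt_integral_of_ae_lt (integrable_zero _ _ _) (S.integrable_powerDensity n q ht) ?_
  filter_upwards [S.ae_noise_le_varianceLaw q] with v hv
  exact powerDensity_pos n (S.noise_pos.trans_le hv) t

theorem continuousOn_powerMixture (n : ℕ) (q : Hypothesis) :
    ContinuousOn (S.powerMixture n q) (Set.Ici 0) := by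
  refine continuousOn_of_dominated (bound := fun _ => 1 / (Real.pi * S.noise) ^ n)
    (fun t _ => ((measurable_powerDensity n).comp
      (measurable_id.prodMk measurable_const)).aestronglyMeasurable) (fun t ht => ?_)
      (integrable_const _) (ae_of_all _ fun v => ?_)
  · filter_upwards [S.ae_noise_le_varianceLaw q] with v hv
    rw [Real.norm_eq_abs, abs_of_pos (powerDensity_pos n (S.noise_pos.trans_le hv) t)]
    exact powerDensity_le n S.noise_pos hv ht
  · unfold powerDensity
    fun_prop

theorem receivedLaw_eq_withDensity {n : ℕ} (hn : 0 < n) (q : Hypothesis) :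
    S.receivedLaw (Fin n) q =
      volume.withDensity fun y => ENNReal.ofReal (S.powerMixture n q (averagePower n y)) := by
  ext A hA
  rw [S.receivedLaw_apply _ _ hA, withDensity_apply _ hA]
  have h1 : ∀ᵐ v ∂S.varianceLaw q, symbolKernel (Fin n) v A =
      ∫⁻ y in A, ENNReal.ofReal (powerDensity n v (averagePower n y)) := by
    filter_upwards [S.ae_noise_le_varianceLaw q] with v hv
    rw [symbolKernel_eq_withDensity hn (S.noise_pos.trans_le hv), withDensity_apply _ hA]
  have hm : Measurable fun p : ℝ × (Fin n → ℂ) =>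
      ENNReal.ofReal (powerDensity n p.1 (averagePower n p.2)) :=
    ((measurable_powerDensity n).comp (measurable_fst.prodMk
      ((measurable_averagePower n).comp measurable_snd))).ennreal_ofReal
  rw [lintegral_congr_ae h1, lintegral_lintegral_swap hm.aemeasurable]
  refine lintegral_congr fun y => ?_
  rw [powerMixture, ofReal_integral_eq_lintegral_ofReal
    (S.integrable_powerDensity n q (averagePower_nonneg n y))]
  filter_upwards [S.ae_noise_le_varianceLaw q] with v hv
  exact (powerDensity_pos n (S.noise_pos.trans_le hv) _).le

theorem integral_varianceLaw_H1 (f : ℝ → ℝ) :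
    ∫ v, f v ∂S.varianceLaw .H1 = ∫ v, S.varianceRatio v * f v ∂S.varianceLaw .H0 := by
  rw [S.varianceLaw_H1_eq_withDensity, integral_withDensity_eq_integral_toReal_smul
    S.monotone_varianceRatio.measurable.ennreal_ofReal (ae_of_all _ fun _ => ENNReal.ofReal_lt_top)]
  simp [ENNReal.toReal_ofReal (S.varianceRatio_nonneg _)]

theorem integrable_varianceRatio_mul {f : ℝ → ℝ} (hf : Integrable f (S.varianceLaw .H1)) :
    Integrable (fun v => S.varianceRatio v * f v) (S.varianceLaw .H0) := by
  rw [S.varianceLaw_H1_eq_withDensity, integrable_withDensity_iff_integrable_smul'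
    S.monotone_varianceRatio.measurable.ennreal_ofReal
    (ae_of_all _ fun _ => ENNReal.ofReal_lt_top)] at hf
  simpa [ENNReal.toReal_ofReal (S.varianceRatio_nonneg _)] using hf

/-- Monotonicity of the likelihood ratio, in cross-multiplied form. -/
theorem powerMixture_mul_le {n : ℕ} (hn : 0 < n) {t t' : ℝ} (ht : 0 ≤ t) (htt' : t < t') :
    S.powerMixture n .H1 t * S.powerMixture n .H0 t' ≤
      S.powerMixture n .H1 t' * S.powerMixture n .H0 t := by
  have ht' := ht.trans htt'.le
  have hm := S.powerMixture_pos n .H0 ht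
  have hm' := S.powerMixture_pos n .H0 ht'
  have hδ : 0 < n * (t' - t) := mul_pos (by positivity) (by linarith)
  set δ := n * (t' - t)
  set ρ := S.powerMixture n .H0 t' / S.powerMixture n .H0 t
  have hρ0 : 0 < ρ := div_pos hm' hm
  have hlt : S.powerMixture n .H0 t' < S.powerMixture n .H0 t := by
    refine integral_lt_integral_of_ae_lt (S.integrable_powerDensity n _ ht')
      (S.integrable_powerDensity n _ ht) ?_
    filter_upwards [S.ae_noise_le_varianceLaw .H0] with v hv
    have hv := S.noise_pos.trans_le hv
    rw [powerDensity_eq_mul n v t t']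
    refine mul_lt_of_lt_one_left (powerDensity_pos n hv t)
      ((Real.exp_lt_exp.2 (div_neg_of_neg_of_pos (neg_neg_of_pos hδ) hv)).trans_eq Real.exp_zero)
  have hlog : Real.log ρ < 0 := Real.log_neg hρ0 ((div_lt_one hm).2 hlt)
  -- The variance at which the tilting factor `exp (-δ / w)` equals its mean `ρ` under the `H0`
  -- weights; it exists because `0 < ρ < 1`.
  set w := -δ / Real.log ρ
  have hw : 0 < w := div_pos_of_neg_of_neg (neg_neg_of_pos hδ) hlog
  have hρ : ρ = Real.exp (-δ / w) := by
    rw [show -δ / w = Real.log ρ by simp only [w]; field_simp, Real.exp_log hρ0]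
  have i0 := S.integrable_powerDensity n .H0 ht
  have i0' := S.integrable_powerDensity n .H0 ht'
  have i1 := S.integrable_varianceRatio_mul (S.integrable_powerDensity n .H1 ht)
  have i1' := S.integrable_varianceRatio_mul (S.integrable_powerDensity n .H1 ht')
  -- The integrand is `(varianceRatio v - varianceRatio w) * (exp (-δ / v) - exp (-δ / w))` times
  -- the density at `t`. Both factors change sign at `w` in the same direction.
  have hnonneg : 0 ≤ ∫ v, ((S.varianceRatio v * powerDensity n v t' -
      ρ * (S.varianceRatio v * powerDensity n v t)) -
      S.varianceRatio w * (powerDensity n v t' - ρ * powerDensity n v t)) ∂S.varianceLaw .H0 := by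
    refine integral_nonneg_of_ae ?_
    filter_upwards [S.ae_noise_le_varianceLaw .H0] with v hv
    have hv := S.noise_pos.trans_le hv
    have key : 0 ≤ (S.varianceRatio v - S.varianceRatio w) *
        (Real.exp (-δ / v) - Real.exp (-δ / w)) := by
      rcases le_total v w with h | h
      · refine mul_nonneg_of_nonpos_of_nonpos (sub_nonpos.2 (S.monotone_varianceRatio h))
          (sub_nonpos.2 (Real.exp_le_exp.2 ?_))
        rw [neg_div, neg_div, neg_le_neg_iff]
        gcongr
      · refine mul_nonneg (sub_nonneg.2 (S.monotone_varianceRatio h))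
          (sub_nonneg.2 (Real.exp_le_exp.2 ?_))
        rw [neg_div, neg_div, neg_le_neg_iff]
        gcongr
    have := mul_nonneg key (powerDensity_pos n hv t).le
    rw [Pi.zero_apply, powerDensity_eq_mul n v t t', hρ]
    linarith
  have j1 : Integrable (fun v => S.varianceRatio v * powerDensity n v t' -
      ρ * (S.varianceRatio v * powerDensity n v t)) (S.varianceLaw .H0) :=
    i1'.sub (i1.const_mul ρ)
  have j0 : Integrable (fun v => powerDensity n v t' - ρ * powerDensity n v t)
      (S.varianceLaw .H0) := i0'.sub (i0.const_mul ρ)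
  rw [integral_sub j1 (j0.const_mul _), integral_sub i1' (i1.const_mul ρ), integral_const_mul, integral_const_mul,
    integral_sub i0' (i0.const_mul ρ), integral_const_mul, ← integral_varianceLaw_H1,
    ← integral_varianceLaw_H1] at hnonneg
  change 0 ≤ (S.powerMixture n .H1 t' - ρ * S.powerMixture n .H1 t) -
    S.varianceRatio w * (S.powerMixture n .H0 t' - ρ * S.powerMixture n .H0 t) at hnonneg
  -- By the choice of `ρ`, the term multiplied by `varianceRatio w` integrates to zero.
  rw [show ρ * S.powerMixture n .H0 t = S.powerMixture n .H0 t' from div_mul_cancel₀ _ hm.ne',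
    sub_self, mul_zero, sub_zero, sub_nonneg, div_mul_eq_mul_div, div_le_iff₀ hm, mul_comm] at hnonneg
  exact hnonneg

/-- The likelihood ratio, as a function of the average power of the symbols. -/
def powerRatio (n : ℕ) (t : ℝ) : ℝ := S.powerMixture n .H1 t / S.powerMixture n .H0 t

theorem likelihoodRatio_eq {n : ℕ} (hn : 0 < n) (y : Fin n → ℂ) :
    S.likelihoodRatio y = S.powerRatio n (averagePower n y) := by
  rw [likelihoodRatio, powerRatio, S.mixtureDensity_eq hn, S.mixtureDensity_eq hn]

theorem monotoneOn_powerRatio {n : ℕ} (hn : 0 < n) : MonotoneOn (S.powerRatio n) (Set.Ici 0) := by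
  intro t ht t' ht' htt'
  rcases htt'.eq_or_lt with rfl | hlt
  · exact le_rfl
  · exact (div_le_div_iff₀ (S.powerMixture_pos n _ ht) (S.powerMixture_pos n _ ht')).2
      (S.powerMixture_mul_le hn ht hlt)

theorem continuousOn_powerRatio (n : ℕ) : ContinuousOn (S.powerRatio n) (Set.Ici 0) :=
  (S.continuousOn_powerMixture n _).div (S.continuousOn_powerMixture n _)
    fun _ ht => (S.powerMixture_pos n _ ht).ne'

/-- At zero power the density is `(π v)⁻ⁿ`, decreasing in `v`. Coupling the hypotheses by the same
`h` makes the variance larger under `H1`, strictly so when `h ≠ 0`, even if `gainRD = 0`. -/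
theorem powerMixture_zero_lt {n : ℕ} (hn : 0 < n) :
    S.powerMixture n .H1 0 < S.powerMixture n .H0 0 := by
  have hm : Measurable fun v => powerDensity n v 0 :=
    (measurable_powerDensity n).comp (measurable_id.prodMk measurable_const)
  have hi : ∀ q, Integrable (fun h => powerDensity n (S.variance q h) 0) S.errorLaw := fun q =>
    (S.integrable_powerDensity n q le_rfl).comp_measurable (S.measurable_variance q)
  have hne : ∀ᵐ h ∂S.errorLaw, h ≠ 0 := by
    rw [errorLaw, complexGaussian_eq_withDensity S.errorVariance_pos]
    refine (withDensity_absolutelyContinuous _ _).ae_le ?_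
    exact Measure.ae_ne volume 0
  simp only [powerMixture, varianceLaw]
  rw [integral_map (S.measurable_variance _).aemeasurable hm.aestronglyMeasurable,
    integral_map (S.measurable_variance _).aemeasurable hm.aestronglyMeasurable]
  refine integral_lt_integral_of_ae_lt (hi _) (hi _) ?_
  filter_upwards [hne] with h hh
  have h0 := S.variance_pos .H0 h
  have hlt : S.variance .H0 h < S.variance .H1 h := by
    have h1 := mul_le_mul_of_nonneg_right S.relayPower_lt.le S.gainRD_nonneg
    have h2 := mul_lt_mul_of_pos_right S.relayPower_lt (pow_pos (norm_pos_iff.2 hh) 2)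
    unfold variance
    linarith
  have := Real.pi_pos
  simp only [powerDensity, mul_zero, neg_zero, zero_div, Real.exp_zero]
  gcongr

/-- Otherwise one probability density lies below the other. Having equal integrals, they agree
almost everywhere, hence everywhere by continuity, against `powerMixture_zero_lt` at zero power. -/
theorem exists_one_lt_powerRatio {n : ℕ} (hn : 0 < n) : ∃ t, 0 ≤ t ∧ 1 < S.powerRatio n t := by
  by_contra! hcon
  let f := fun q (y : Fin n → ℂ) => S.powerMixture n q (averagePower n y)
  have hc : ∀ q, Continuous fun y => ENNReal.ofReal (f q y) := fun q =>
    ENNReal.continuous_ofReal.comp ((S.continuousOn_powerMixture n q).comp_continuous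
      (continuous_averagePower n) (averagePower_nonneg n))
  have hle : ∀ y, f .H1 y ≤ f .H0 y := fun y =>
    (div_le_one (S.powerMixture_pos n _ (averagePower_nonneg n y))).1
      (hcon _ (averagePower_nonneg n y))
  have hone : ∀ q, ∫⁻ y, ENNReal.ofReal (f q y) = 1 := fun q => by
    rw [← setLIntegral_univ, ← withDensity_apply _ MeasurableSet.univ,
      ← S.receivedLaw_eq_withDensity hn, measure_univ]
  have hae := ae_eq_of_ae_le_of_lintegral_le (ae_of_all volume fun y => ENNReal.ofReal_le_ofReal (hle y))
    (by simp [hone]) (hc .H0).measurable.aemeasurable (by rw [hone, hone])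
  obtain ⟨y, hy⟩ := exists_averagePower_eq hn le_rfl
  have h0 := congrFun ((Continuous.ae_eq_iff_eq volume (hc .H1) (hc .H0)).1 hae) y
  rw [ENNReal.ofReal_eq_ofReal_iff
    (S.powerMixture_pos n _ (averagePower_nonneg n y)).le
    (S.powerMixture_pos n _ (averagePower_nonneg n y)).le] at h0
  simp only [hy] at h0
  exact (S.powerMixture_zero_lt hn).ne h0

theorem exists_powerRatio_threshold {n : ℕ} (hn : 0 < n) :
    ∃ τ, ∀ t, 0 ≤ t → (1 < S.powerRatio n t ↔ τ < t) := by
  obtain ⟨b, hb, hb1⟩ := S.exists_one_lt_powerRatio hn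
  let B := Set.Ici 0 ∩ S.powerRatio n ⁻¹' Set.Iic 1
  have hclosed : IsClosed B :=
    (S.continuousOn_powerRatio n).preimage_isClosed_of_isClosed isClosed_Ici isClosed_Iic
  have hne : B.Nonempty :=
    ⟨0, Set.self_mem_Ici, ((div_lt_one (S.powerMixture_pos n _ le_rfl)).2 (S.powerMixture_zero_lt hn)).le⟩
  have hbdd : BddAbove B := ⟨b, fun t ht => le_of_not_gt fun hbt =>
    ht.2.not_gt (hb1.trans_le (S.monotoneOn_powerRatio hn hb ht.1 hbt.le))⟩
  -- Closedness puts the supremum itself in `B`, which makes both inequalities of the equivalence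
  -- strict.
  have hmem : sSup B ∈ B := hclosed.csSup_mem hne hbdd
  refine ⟨sSup B, fun t ht => ⟨fun h => lt_of_not_ge fun hle => ?_, fun h => ?_⟩⟩
  · exact h.not_ge ((S.monotoneOn_powerRatio hn ht hmem.1 hle).trans hmem.2)
  · exact lt_of_not_ge fun hle => h.not_ge (le_csSup hbdd ⟨ht, hle⟩)

theorem mul_receivedLaw_fin_le {n : ℕ} (hn : 0 < n) {k : ℝ} (hk : 0 ≤ k) {A : Set (Fin n → ℂ)}
    (h : ∀ y ∈ A, k ≤ S.powerRatio n (averagePower n y)) (hA : MeasurableSet A) :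
    ENNReal.ofReal k * S.receivedLaw (Fin n) .H0 A ≤ S.receivedLaw (Fin n) .H1 A := by
  rw [S.receivedLaw_eq_withDensity hn, S.receivedLaw_eq_withDensity hn, withDensity_apply _ hA,
    withDensity_apply _ hA, ← lintegral_const_mul' _ _ ENNReal.ofReal_ne_top]
  refine setLIntegral_mono' hA fun y hy => ?_
  rw [← ENNReal.ofReal_mul hk]
  exact ENNReal.ofReal_le_ofReal
    ((le_div_iff₀ (S.powerMixture_pos n _ (averagePower_nonneg n y))).1 (h y hy))

theorem receivedLaw_fin_le_mul {n : ℕ} (hn : 0 < n) {k : ℝ} (hk : 0 ≤ k) {A : Set (Fin n → ℂ)}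
    (h : ∀ y ∈ A, S.powerRatio n (averagePower n y) ≤ k) (hA : MeasurableSet A) :
    S.receivedLaw (Fin n) .H1 A ≤ ENNReal.ofReal k * S.receivedLaw (Fin n) .H0 A := by
  rw [S.receivedLaw_eq_withDensity hn, S.receivedLaw_eq_withDensity hn, withDensity_apply _ hA,
    withDensity_apply _ hA, ← lintegral_const_mul' _ _ ENNReal.ofReal_ne_top]
  refine setLIntegral_mono' hA fun y hy => ?_
  rw [← ENNReal.ofReal_mul hk]
  exact ENNReal.ofReal_le_ofReal
    ((div_le_iff₀ (S.powerMixture_pos n _ (averagePower_nonneg n y))).1 (h y hy))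

theorem minimizesError_radiometer {n : ℕ} (hn : 0 < n) {τ : ℝ}
    (h : ∀ t, 0 ≤ t → (1 < S.powerRatio n t ↔ τ < t)) : S.MinimizesError (radiometer n τ) := by
  refine S.minimizesError_thresholdDetector (measurable_averagePower n) (fun A hA hAm => ?_)
    (fun A hA hAm => ?_)
  · simpa using S.mul_receivedLaw_fin_le hn zero_le_one
      (fun y hy => ((h _ (averagePower_nonneg n y)).2 (hA hy)).le) hAm
  · simpa using S.receivedLaw_fin_le_mul hn zero_le_one (fun y hy => le_of_not_gt fun hlt =>
      ((h _ (averagePower_nonneg n y)).1 hlt).not_ge (hA hy)) hAm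

theorem mostPowerful_radiometer {n : ℕ} (hn : 0 < n) (τ : ℝ) :
    S.MostPowerful (radiometer n τ) := by
  -- The ratio is monotone only on `[0, ∞)`. Since the power is nonnegative, truncating a negative
  -- threshold at `0` still gives a valid constant `k`.
  have h0 : (0 : ℝ) ≤ max τ 0 := le_max_right _ _
  have hk : 0 ≤ S.powerRatio n (max τ 0) :=
    (div_pos (S.powerMixture_pos n _ h0) (S.powerMixture_pos n _ h0)).le
  refine S.mostPowerful_thresholdDetector (measurable_averagePower n)
    (k := (S.powerRatio n (max τ 0)).toNNReal) (fun A hA hAm => ?_) (fun A hA hAm => ?_)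
  · refine S.mul_receivedLaw_fin_le hn hk (fun y hy => ?_) hAm
    exact S.monotoneOn_powerRatio hn h0 (averagePower_nonneg n y)
      (max_le (le_of_lt (hA hy)) (averagePower_nonneg n y))
  · refine S.receivedLaw_fin_le_mul hn hk (fun y hy => ?_) hAm
    exact S.monotoneOn_powerRatio hn (averagePower_nonneg n y) h0
      (le_max_of_le_left (hA hy))

theorem exists_falseAlarm_radiometer_eq {n : ℕ} (hn : 0 < n) {α : ℝ}
    (hα : α ∈ Set.Ioc (0 : ℝ) 1) : ∃ τ, S.falseAlarm (radiometer n τ) = α := by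
  refine exists_integral_thresholdDetector_eq (S.receivedLaw (Fin n) .H0)
    -- With `b = -1` the strict bound holds for every `y`, including `y = 0`.
    (measurable_averagePower n) (fun a => ?_) (b := -1)
    (ae_of_all _ fun y => neg_one_lt_zero.trans_le (averagePower_nonneg n y)) hα
  rw [S.receivedLaw_eq_withDensity hn]
  exact withDensity_absolutelyContinuous _ _ (volume_averagePower_eq hn a)

end Slot

end CovertDetection

end

theorem lemma1 (S : CovertDetection.Slot) :
    -- every blocklength
    (∀ n : ℕ, 0 < n →
      (∀ y y' : Fin n → ℂ,
        CovertDetection.averagePower n y ≤ CovertDetection.averagePower n y' →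
        S.likelihoodRatio y ≤ S.likelihoodRatio y') ∧
      (∃ τ : ℝ,
        (∀ y : Fin n → ℂ, 1 < S.likelihoodRatio y ↔ τ < CovertDetection.averagePower n y) ∧
        S.MinimizesError (CovertDetection.radiometer n τ)) ∧
      (∀ τ : ℝ, S.MostPowerful (CovertDetection.radiometer n τ)) ∧
      (∀ α ∈ Set.Ioc (0 : ℝ) 1, ∃ τ : ℝ, S.falseAlarm (CovertDetection.radiometer n τ) = α)) ∧
    -- law of large numbers for the received power
    (∀ (q : CovertDetection.Hypothesis) (h : ℂ), ∀ᵐ y ∂S.receivedKernel ℕ q h,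
      Tendsto (CovertDetection.partialPower y) atTop (𝓝 (S.variance q h))) ∧
    (∀ τ : ℝ,
      Tendsto (fun n => S.falseAlarm (CovertDetection.radiometer n τ)) atTop
        (𝓝 (S.falseAlarm (CovertDetection.limitRadiometer τ))) ∧
      Tendsto (fun n => S.missedDetection (CovertDetection.radiometer n τ)) atTop
        (𝓝 (S.missedDetection (CovertDetection.limitRadiometer τ)))) ∧
    -- infinite blocklength
    (∃ τ : ℝ, S.MinimizesError (CovertDetection.limitRadiometer τ)) ∧
    (∀ τ : ℝ, S.MostPowerful (CovertDetection.limitRadiometer τ)) ∧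
    (∀ α ∈ Set.Ioc (0 : ℝ) 1, ∃ τ : ℝ,
      S.falseAlarm (CovertDetection.limitRadiometer τ) = α) := by
  refine ⟨fun n hn => ⟨fun y y' hyy' => ?_, ?_, S.mostPowerful_radiometer hn,
      fun α hα => S.exists_falseAlarm_radiometer_eq hn hα⟩, fun q h => ?_, fun τ => ⟨?_, ?_⟩,
    S.exists_minimizesError_limitRadiometer, S.mostPowerful_limitRadiometer,
    fun α hα => S.exists_falseAlarm_limitRadiometer_eq hα⟩
  · rw [S.likelihoodRatio_eq hn, S.likelihoodRatio_eq hn]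
    exact S.monotoneOn_powerRatio hn (CovertDetection.averagePower_nonneg n y)
      (CovertDetection.averagePower_nonneg n y') hyy'
  · obtain ⟨τ, hτ⟩ := S.exists_powerRatio_threshold hn
    refine ⟨τ, fun y => ?_, S.minimizesError_radiometer hn hτ⟩
    rw [S.likelihoodRatio_eq hn]
    exact hτ _ (CovertDetection.averagePower_nonneg n y)
  · rw [S.receivedKernel_apply]
    exact CovertDetection.ae_tendsto_partialPower (S.variance_pos q h).le
  · exact S.tendsto_integral_radiometer .H0 τ
  · simp only [S.missedDetection_eq_one_sub]
    exact (S.tendsto_integral_radiometer .H1 τ).const_sub 1
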